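/- Throughout, a convex body in $\mathbb{R}^n$ is a compact convex set with non-empty interior; a polytope $P\subset\mathbb{R}^n$ is a convex body that is an intersection of finitely many closed half-spaces, and its facets are its $(n-1)$-dimensional faces. The John ellipsoid of a convex body $K$ is the ellipsoid of maximal volume contained in $K$; $K$ is in John's position if its John ellipsoid is the closed Euclidean unit ball centered at the origin. The center of mass of $K$ is $x_K=\frac{1}{\mathrm{vol}(K)}\int_K x\,dx$, and $|\cdot|$ is the Euclidean norm. There exist universal constants $C_0,C_1,C_2>0$ and $N\in\mathbb{N}$ such that for every $n\ge N$: (1) There exists a convex body $K\subset\mathbb{R}^n$ whose center of mass does not lie in the John ellipsoid of $K$ dilated by the factor $\left(1-C_0\sqrt{\frac{\log n}{n}}\right)n$ about the ellipsoid's center. (2) There exists a polytope $P\subset\mathbb{R}^n$ with at most $C_2n^2$ facets whose center of mass does not lie in the John ellipsoid of $P$ dilated by the factor $C_1\frac{n}{\log n}$ about the ellipsoid's center. Moreover, for every $n\ge N$, with the same constants: (1') There exists a convex body $K\subset\mathbb{R}^n$ in John's position with $|x_K|\ge\left(1-C_0\sqrt{\frac{\log n}{n}}\right)n$. (2') There exists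 a polytope $P\subset\mathbb{R}^n$ in John's position with at most $C_2n^2$ facets and $|x_P|\ge C_1\frac{n}{\log n}$. -/

import Mathlib

open MeasureTheory

/-- A convex body in `ℝⁿ`: a compact convex set with non-empty interior.
(Mathlib's `ConvexBody` only asks for a non-empty set.) -/
structure IsConvexBody {n : ℕ} (K : Set (EuclideanSpace ℝ (Fin n))) : Prop where
  convex : Convex ℝ K
  isCompact : IsCompact K
  interior_nonempty : (interior K).Nonempty

/-- `E` is a (closed, non-degenerate) ellipsoid with center `c`: the image `c + A B` of the closed
Euclidean unit ball `B` under an invertible affine map `x ↦ c + A x`. -/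
def IsEllipsoid {n : ℕ} (c : EuclideanSpace ℝ (Fin n))
    (E : Set (EuclideanSpace ℝ (Fin n))) : Prop :=
  ∃ A : EuclideanSpace ℝ (Fin n) ≃L[ℝ] EuclideanSpace ℝ (Fin n),
    E = (fun x => c + A x) '' Metric.closedBall 0 1

/-- `E` is the John ellipsoid of `K`, and `c` is its center: `E` is an ellipsoid contained in `K`
whose volume is maximal among all ellipsoids contained in `K`. -/
structure IsJohnEllipsoid {n : ℕ} (c : EuclideanSpace ℝ (Fin n))
    (E K : Set (EuclideanSpace ℝ (Fin n))) : Prop where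
  isEllipsoid : IsEllipsoid c E
  subset : E ⊆ K
  volume_le : ∀ (c' : EuclideanSpace ℝ (Fin n)) (E' : Set (EuclideanSpace ℝ (Fin n))),
    IsEllipsoid c' E' → E' ⊆ K → volume E' ≤ volume E

/-- `K` is in John's position: its John ellipsoid is the closed Euclidean unit ball. -/
def InJohnPosition {n : ℕ} (K : Set (EuclideanSpace ℝ (Fin n))) : Prop :=
  IsJohnEllipsoid 0 (Metric.closedBall 0 1) K

/-- The center of mass `vol(K)⁻¹ ∫_K x dx` of `K`. -/
noncomputable def centerOfMass {n : ℕ} (K : Set (EuclideanSpace ℝ (Fin n))) :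
    EuclideanSpace ℝ (Fin n) :=
  (volume.real K)⁻¹ • ∫ x in K, x

/-- The dilation `{c + r (x - c) : x ∈ E}` of `E` by the factor `r` about the point `c`. -/
def dilate {n : ℕ} (c : EuclideanSpace ℝ (Fin n)) (r : ℝ)
    (E : Set (EuclideanSpace ℝ (Fin n))) : Set (EuclideanSpace ℝ (Fin n)) :=
  (fun x => c + r • (x - c)) '' E

/-- A convex polytope: a bounded intersection of finitely many closed half-spaces. -/
def IsPolytope {n : ℕ} (P : Set (EuclideanSpace ℝ (Fin n))) : Prop :=
  Bornology.IsBounded P ∧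
    ∃ H : Finset (EuclideanSpace ℝ (Fin n) × ℝ), P = {x | ∀ h ∈ H, inner ℝ h.1 x ≤ h.2}

/-- The facets of `P ⊆ ℝⁿ`: its non-empty exposed faces of dimension `n - 1`. -/
def facets {n : ℕ} (P : Set (EuclideanSpace ℝ (Fin n))) :
    Set (Set (EuclideanSpace ℝ (Fin n))) :=
  {F | F.Nonempty ∧ IsExposed ℝ P F ∧ Module.finrank ℝ (vectorSpan ℝ F) + 1 = n}

/-!
Both bodies are parts of a cone `coneOverCube m` in `ℝᵐ⁺¹`, with apex at height `m + 1` over an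
`m`-dimensional cube at height `-1`. Its facets touch the unit ball at points that decompose the
identity, so by John's criterion (`inJohnPosition_of_contact_points`) every set between the unit
ball and the cone is in John's position. The cone itself has its center of mass at the origin. To
move the center of mass towards the apex, the cone is cut by further constraints that keep the unit
ball, take away nearly all of the volume of the low part, where the sections are large cubes, but
leave most or all of the sections near the apex, which are small cubes.

* `ballTruncatedCone`: the section at height `s` is cut by a ball of radius about `1 + s / n`, where
  `n = m + 1`. By concentration of measure (`half_volume_closedBall_le`), at least half of such a
  ball lies in the cube of relative half-width `δ`, of order `√(log n / n)`. So up to height about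
  `(1 - 2δ) n` the volumes of the sections are those of the balls, up to a factor `2`. They grow
  geometrically with the height, hence nearly all of the volume lies above height `(1 - 4δ) n`.
* `pairTruncatedCone`: the section is cut by bounds on `|yᵢ| + |yⱼ|` for all pairs `i ≠ j`, which are
  `O(n²)` linear inequalities. At a low height at most one coordinate exceeds half the bound, so the
  section is covered by `m` boxes whose total volume is exponentially smaller than that of the cube
  (`volume_real_low_pairTruncatedCone_le`), while from height `n / 20` on the bounds are implied by
  the cube. So the center of mass has norm at least `n / 80`, which is more than `n / (100 log n)`.

In both cases the center of mass is estimated from the fraction of the volume below a given height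
(`le_norm_centerOfMass`). The estimates are strict, so the center of mass lies outside the
dilated unit ball too.
-/

/-! ### John's criterion -/

section John

lemma LinearMap.det_adjoint_real {E : Type*} [NormedAddCommGroup E] [InnerProductSpace ℝ E]
    [FiniteDimensional ℝ E] (T : E →ₗ[ℝ] E) :
    LinearMap.det (LinearMap.adjoint T) = LinearMap.det T := by
  let b := stdOrthonormalBasis ℝ E
  rw [← LinearMap.det_toMatrix b.toBasis, ← LinearMap.det_toMatrix b.toBasis T,
    LinearMap.toMatrix_adjoint, Matrix.det_conjTranspose]
  simp

variable {E : Type*} [NormedAddCommGroup E] [InnerProductSpace ℝ E] [FiniteDimensional ℝ E]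
  {ι : Type*} [Fintype ι] {w : ι → ℝ} {u : ι → E}

lemma sum_weights_eq_finrank (hu : ∀ i, ‖u i‖ = 1)
    (hid : ∀ x : E, ∑ i, w i * inner ℝ (u i) x ^ 2 = ‖x‖ ^ 2) :
    ∑ i, w i = Module.finrank ℝ E := by
  have b := stdOrthonormalBasis ℝ E
  have h : ∑ k, ‖b k‖ ^ 2 = Module.finrank ℝ E := by simp
  rw [← h]
  simp_rw [← hid]
  rw [Finset.sum_comm]
  refine Finset.sum_congr rfl fun i _ => ?_
  rw [← Finset.mul_sum, b.sum_sq_inner_left, hu, one_pow, mul_one]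

/-- If the `u i` decompose the identity with weights `w i`, then the average of the `‖T (u i)‖`
dominates the geometric mean of the singular values of `T`. -/
lemma abs_det_le_one_of_sum_norm_le (hw : ∀ i, 0 ≤ w i) (hu : ∀ i, ‖u i‖ = 1)
    (hid : ∀ x : E, ∑ i, w i * inner ℝ (u i) x ^ 2 = ‖x‖ ^ 2) (T : E →ₗ[ℝ] E)
    (hT : ∑ i, w i * ‖T (u i)‖ ≤ Module.finrank ℝ E) : |LinearMap.det T| ≤ 1 := by
  have hS : (LinearMap.adjoint T ∘ₗ T).IsSymmetric := by
    intro x y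
    simp [LinearMap.adjoint_inner_left, LinearMap.adjoint_inner_right]
  let b := hS.eigenvectorBasis rfl
  let l := hS.eigenvalues rfl
  have hl : ∀ k, l k = ‖T (b k)‖ ^ 2 := by
    intro k
    have h1 : inner ℝ (b k) ((LinearMap.adjoint T ∘ₗ T) (b k)) = l k := by
      rw [hS.apply_eigenvectorBasis rfl k, inner_smul_right]
      change (l k : ℝ) * inner ℝ (b k) (b k) = l k
      simp
    rw [← h1, LinearMap.comp_apply, LinearMap.adjoint_inner_right, real_inner_self_eq_norm_sq]
  have hnorm : ∀ x, ‖T x‖ ^ 2 = ∑ k, l k * inner ℝ (b k) x ^ 2 := by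
    intro x
    rw [← real_inner_self_eq_norm_sq, ← LinearMap.adjoint_inner_right,
      ← b.sum_inner_mul_inner x (LinearMap.adjoint T (T x))]
    refine Finset.sum_congr rfl fun k _ => ?_
    have h1 : inner ℝ (b k) ((LinearMap.adjoint T ∘ₗ T) x) = l k * inner ℝ (b k) x := by
      rw [← hS (b k) x, hS.apply_eigenvectorBasis rfl k, inner_smul_left]
      rfl
    rw [LinearMap.comp_apply] at h1
    rw [h1, real_inner_comm]
    ring
  have hkey : ∀ i, ∑ k, ‖T (b k)‖ * inner ℝ (b k) (u i) ^ 2 ≤ ‖T (u i)‖ := by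
    intro i
    refine le_of_sq_le_sq ?_ (norm_nonneg _)
    have h := Finset.sum_mul_sq_le_sq_mul_sq Finset.univ
      (fun k => ‖T (b k)‖ * inner ℝ (b k) (u i)) (fun k => inner ℝ (b k) (u i))
    rw [b.sum_sq_inner_right, hu, one_pow, mul_one] at h
    rw [hnorm]
    convert h using 2
    · refine Finset.sum_congr rfl fun k _ => ?_
      ring
    · rw [hl]
      ring
  have hsum : ∑ k, ‖T (b k)‖ ≤ Module.finrank ℝ E := by
    calc ∑ k, ‖T (b k)‖ = ∑ k, ‖T (b k)‖ * ∑ i, w i * inner ℝ (u i) (b k) ^ 2 := by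
          simp [hid]
      _ = ∑ i, w i * ∑ k, ‖T (b k)‖ * inner ℝ (b k) (u i) ^ 2 := by
          simp_rw [Finset.mul_sum]
          rw [Finset.sum_comm]
          refine Finset.sum_congr rfl fun i _ => Finset.sum_congr rfl fun k _ => ?_
          rw [real_inner_comm]
          ring
      _ ≤ ∑ i, w i * ‖T (u i)‖ :=
          Finset.sum_le_sum fun i _ => mul_le_mul_of_nonneg_left (hkey i) (hw i)
      _ ≤ _ := hT
  have hprod : ∏ k, ‖T (b k)‖ ≤ 1 := by
    calc ∏ k, ‖T (b k)‖ ≤ ∏ k, Real.exp (‖T (b k)‖ - 1) := by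
          refine Finset.prod_le_prod (fun _ _ => norm_nonneg _) fun k _ => ?_
          linarith [Real.add_one_le_exp (‖T (b k)‖ - 1)]
      _ = Real.exp (∑ k, ‖T (b k)‖ - Module.finrank ℝ E) := by
          rw [← Real.exp_sum, Finset.sum_sub_distrib]
          simp
      _ ≤ 1 := Real.exp_le_one_iff.2 (by linarith)
  have hdet : LinearMap.det T ^ 2 = (∏ k, ‖T (b k)‖) ^ 2 := by
    rw [← Finset.prod_pow]
    have h := hS.det_eq_prod_eigenvalues rfl
    rw [LinearMap.det_comp, LinearMap.det_adjoint_real] at h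
    simp only [← hl]
    simp only [RCLike.ofReal_real_eq_id, id] at h
    rw [← h, sq]
  rw [← abs_of_nonneg (Finset.prod_nonneg fun k _ => norm_nonneg (T (b k)))] at hprod
  rw [sq_eq_sq_iff_abs_eq_abs] at hdet
  rwa [hdet]

end John

/-- John's criterion: a set squeezed between the unit ball and the tangent half-spaces at contact
points that decompose the identity has the unit ball as its ellipsoid of maximal volume. -/
theorem inJohnPosition_of_contact_points {n : ℕ} {K : Set (EuclideanSpace ℝ (Fin n))}
    {ι : Type*} [Fintype ι] {w : ι → ℝ} {u : ι → EuclideanSpace ℝ (Fin n)}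
    (hw : ∀ i, 0 ≤ w i) (hu : ∀ i, ‖u i‖ = 1) (hcent : ∑ i, w i • u i = 0)
    (hid : ∀ x, ∑ i, w i * inner ℝ (u i) x ^ 2 = ‖x‖ ^ 2)
    (hball : Metric.closedBall 0 1 ⊆ K) (hK : ∀ x ∈ K, ∀ i, inner ℝ (u i) x ≤ 1) :
    InJohnPosition K := by
  refine ⟨⟨ContinuousLinearEquiv.refl ℝ _, by simp⟩, hball, ?_⟩
  rintro c E ⟨A, rfl⟩ hE
  let T := LinearMap.adjoint (A : EuclideanSpace ℝ (Fin n) →ₗ[ℝ] EuclideanSpace ℝ (Fin n))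
  have hsupp : ∀ i, inner ℝ (u i) c + ‖T (u i)‖ ≤ 1 := by
    intro i
    -- the support function of the ellipsoid is attained at the image of this vector
    have hv : ‖T (u i)‖⁻¹ • T (u i) ∈
        Metric.closedBall (0 : EuclideanSpace ℝ (Fin n)) 1 := by
      rw [mem_closedBall_zero_iff, norm_smul, norm_inv, norm_norm]
      exact inv_mul_le_one
    have h := hK _ (hE ⟨_, hv, rfl⟩) i
    have h2 : inner ℝ (u i) (A (‖T (u i)‖⁻¹ • T (u i))) = ‖T (u i)‖ := by
      have h3 : inner ℝ (T (u i)) (‖T (u i)‖⁻¹ • T (u i)) =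
          inner ℝ (u i) (A (‖T (u i)‖⁻¹ • T (u i))) :=
        LinearMap.adjoint_inner_left _ _ _
      rw [← h3, inner_smul_right, real_inner_self_eq_norm_sq]
      by_cases h0 : ‖T (u i)‖ = 0
      · simp [h0]
      · field_simp
    rw [inner_add_right, h2] at h
    exact h
  have hT : ∑ i, w i * ‖T (u i)‖ ≤ Module.finrank ℝ (EuclideanSpace ℝ (Fin n)) := by
    rw [← sum_weights_eq_finrank hu hid]
    have h0 : ∑ i, w i * inner ℝ (u i) c = 0 := by
      have := congrArg (fun v => inner ℝ v c) hcent
      simpa [sum_inner, inner_smul_left] using this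
    calc ∑ i, w i * ‖T (u i)‖ = ∑ i, w i * (inner ℝ (u i) c + ‖T (u i)‖) := by
          simp_rw [mul_add]
          rw [Finset.sum_add_distrib, h0, zero_add]
      _ ≤ ∑ i, w i := Finset.sum_le_sum fun i _ =>
          mul_le_of_le_one_right (hw i) (hsupp i)
  have hdet := abs_det_le_one_of_sum_norm_le hw hu hid T hT
  rw [LinearMap.det_adjoint_real] at hdet
  have himage : (fun x => c + A x) '' Metric.closedBall 0 1
      = (fun x => c + x) '' (A '' Metric.closedBall 0 1) := by
    rw [Set.image_image]
  rw [himage, Set.image_add_left, measure_preimage_add,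
    Measure.addHaar_image_continuousLinearEquiv]
  refine mul_le_of_le_one_left (by positivity) ?_
  rw [ENNReal.ofReal_le_one]
  simpa using hdet

/-! ### Counting facets -/

section Facets

variable {n : ℕ} {ι : Type*} [Fintype ι] {v : ι → EuclideanSpace ℝ (Fin n)} {b : ι → ℝ}

/-- A convex subset of a polyhedron whose points all make some inequality tight lies in one of the
bounding hyperplanes: otherwise an average of points, one off each hyperplane, makes none tight. -/
lemma exists_forall_inner_eq {F : Set (EuclideanSpace ℝ (Fin n))} (hconv : Convex ℝ F)
    (hF : F.Nonempty) (hle : ∀ x ∈ F, ∀ i, inner ℝ (v i) x ≤ b i)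
    (htight : ∀ x ∈ F, ∃ i, inner ℝ (v i) x = b i) : ∃ i, ∀ x ∈ F, inner ℝ (v i) x = b i := by
  by_contra! h
  choose y hyF hy using h
  obtain ⟨x₀, hx₀⟩ := hF
  obtain ⟨i₀, -⟩ := htight x₀ hx₀
  have hcard : (0 : ℝ) < Fintype.card ι := by
    exact_mod_cast Fintype.card_pos_iff.2 ⟨i₀⟩
  have hsum : ∑ _i : ι, (Fintype.card ι : ℝ)⁻¹ = 1 := by
    simp [hcard.ne']
  obtain ⟨i, hi⟩ := htight (∑ j, (Fintype.card ι : ℝ)⁻¹ • y j)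
    (hconv.sum_mem (fun _ _ => by positivity) hsum fun j _ => hyF j)
  refine hi.not_lt ?_
  rw [inner_sum]
  calc ∑ j, inner ℝ (v i) ((Fintype.card ι : ℝ)⁻¹ • y j)
      < ∑ _j : ι, (Fintype.card ι : ℝ)⁻¹ * b i := by
        simp_rw [inner_smul_right]
        refine Finset.sum_lt_sum (fun j _ => ?_) ⟨i, Finset.mem_univ _, ?_⟩
        · exact mul_le_mul_of_nonneg_left (hle _ (hyF j) i) (by positivity)
        · exact mul_lt_mul_of_pos_left (lt_of_le_of_ne (hle _ (hyF i) i) (hy i)) (by positivity)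
    _ = b i := by rw [← Finset.sum_mul, hsum, one_mul]

/-- Each facet of a full-dimensional polyhedron is cut out by one of its inequalities: the facet
lies in some bounding hyperplane, which for reasons of dimension is also the supporting hyperplane
that exposes the facet. -/
lemma exists_facet_eq {F : Set (EuclideanSpace ℝ (Fin n))} (hv : ∀ i, v i ≠ 0)
    (hint : (interior {x | ∀ i, inner ℝ (v i) x ≤ b i}).Nonempty)
    (hF : F ∈ facets {x | ∀ i, inner ℝ (v i) x ≤ b i}) :
    ∃ i, F = {x | (∀ i, inner ℝ (v i) x ≤ b i) ∧ inner ℝ (v i) x = b i} := by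
  obtain ⟨hne, hexp, hdim⟩ := hF
  have hPconv : Convex ℝ {x | ∀ i, inner ℝ (v i) x ≤ b i} := by
    rw [Set.ofPred_forall]
    exact convex_iInter fun i => convex_halfSpace_le (innerₛₗ ℝ (v i)).isLinear _
  have hsub : F ⊆ {x | ∀ i, inner ℝ (v i) x ≤ b i} := hexp.subset
  obtain ⟨l, hl⟩ := hexp hne
  have hl0 : l ≠ 0 := by
    rintro rfl
    have hFP : F = {x | ∀ i, inner ℝ (v i) x ≤ b i} := by
      rw [hl]
      ext x
      simp
    rw [hFP, ← direction_affineSpan, hPconv.interior_nonempty_iff_affineSpan_eq_top.1 hint,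
      AffineSubspace.direction_top, finrank_top, finrank_euclideanSpace_fin] at hdim
    omega
  obtain ⟨i, hi⟩ := exists_forall_inner_eq (hexp.convex hPconv) hne hsub (by
    intro x hx
    by_contra! h
    refine hl0 ?_
    have hnhds : ∀ᶠ y in nhds x, ∀ i, inner ℝ (v i) y ≤ b i := by
      rw [Filter.eventually_all]
      intro i
      have hcont : Continuous fun y => inner ℝ (v i) y := by fun_prop
      filter_upwards [hcont.continuousAt.eventually_lt continuousAt_const
        (lt_of_le_of_ne (hsub hx i) (h i))] with y hy using hy.le
    rw [hl] at hx
    have hmax : IsLocalMax l x := by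
      filter_upwards [hnhds] with y hy using hx.2 y hy
    simpa using hmax.fderiv_eq_zero)
  have hker : ∀ f : EuclideanSpace ℝ (Fin n) →ₗ[ℝ] ℝ, f ≠ 0 →
      (∀ x ∈ F, ∀ y ∈ F, f x = f y) → vectorSpan ℝ F = LinearMap.ker f := by
    intro f hf hconst
    refine Submodule.eq_of_le_of_finrank_eq ?_ ?_
    · rw [vectorSpan_def, Submodule.span_le]
      rintro _ ⟨x, hx, y, hy, rfl⟩
      simp [hconst x hx y hy]
    · have h1 := f.finrank_range_add_finrank_ker
      rw [LinearMap.range_eq_top.2 (LinearMap.surjective hf), finrank_top,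
        finrank_euclideanSpace_fin] at h1
      simp only [Module.finrank_self] at h1
      omega
  have hk1 := hker l (by
      intro h
      apply hl0
      ext x
      simpa using LinearMap.congr_fun h x) (by
    intro x hx y hy
    rw [hl] at hx hy
    exact le_antisymm (hy.2 x hx.1) (hx.2 y hy.1))
  have hk2 := hker (innerₛₗ ℝ (v i)) (by
      intro h
      have := LinearMap.congr_fun h (v i)
      simp [hv i] at this) (by
    intro x hx y hy
    simp [hi x hx, hi y hy])
  refine ⟨i, Set.Subset.antisymm (fun x hx => ⟨hsub hx, hi x hx⟩) ?_⟩
  rintro x ⟨hxP, hxi⟩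
  obtain ⟨x₀, hx₀⟩ := hne
  have hmem : x - x₀ ∈ LinearMap.ker (innerₛₗ ℝ (v i)) := by
    simp [inner_sub_right, hxi, hi x₀ hx₀]
  rw [← hk2, hk1, LinearMap.mem_ker, map_sub, sub_eq_zero] at hmem
  rw [hl] at hx₀ ⊢
  refine ⟨hxP, fun y hy => ?_⟩
  have : l x = l x₀ := hmem
  rw [this]
  exact hx₀.2 y hy

theorem facets_finite_and_ncard_le (hv : ∀ i, v i ≠ 0)
    (hint : (interior {x | ∀ i, inner ℝ (v i) x ≤ b i}).Nonempty) :
    (facets {x | ∀ i, inner ℝ (v i) x ≤ b i}).Finite ∧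
      (facets {x | ∀ i, inner ℝ (v i) x ≤ b i}).ncard ≤ Fintype.card ι := by
  have hsub : facets {x | ∀ i, inner ℝ (v i) x ≤ b i} ⊆
      Set.range fun i => {x | (∀ i, inner ℝ (v i) x ≤ b i) ∧ inner ℝ (v i) x = b i} := by
    intro F hF
    obtain ⟨i, hi⟩ := exists_facet_eq hv hint hF
    exact ⟨i, hi.symm⟩
  refine ⟨(Set.finite_range _).subset hsub, (Set.ncard_le_ncard hsub (Set.finite_range _)).trans ?_⟩
  rw [← Set.image_univ]
  refine (Set.ncard_image_le Set.finite_univ).trans ?_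
  rw [Set.ncard_univ, Nat.card_eq_fintype_card]

lemma isPolytope_setOf_forall_inner_le
    (hbdd : Bornology.IsBounded {x | ∀ i, inner ℝ (v i) x ≤ b i}) :
    IsPolytope {x | ∀ i, inner ℝ (v i) x ≤ b i} := by
  classical
  exact ⟨hbdd, Finset.univ.image fun i => (v i, b i), by simp⟩

end Facets

/-! ### Center of mass and volumes of cylinders -/

section CenterOfMass

variable {m : ℕ}

/-- If `K` has height at least `-1` and at most a fraction `ρ` of its volume lies below height `s`,
then its center of mass is far from the origin. -/
lemma le_norm_centerOfMass {K : Set (EuclideanSpace ℝ (Fin (m + 1)))} (hK : IsCompact K)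
    (hpos : 0 < volume.real K) (hheight : ∀ x ∈ K, -1 ≤ x 0) {s ρ : ℝ} (hs : 0 ≤ s + 1)
    (hlow : volume.real (K ∩ {x | x 0 < s}) ≤ ρ * volume.real K) :
    s - (s + 1) * ρ ≤ ‖centerOfMass K‖ := by
  have hfin : volume K ≠ ⊤ := hK.measure_lt_top.ne
  have hcont : Continuous fun x : EuclideanSpace ℝ (Fin (m + 1)) => x 0 := by fun_prop
  have hmeas : MeasurableSet {x : EuclideanSpace ℝ (Fin (m + 1)) | x 0 < s} :=
    (isOpen_lt hcont continuous_const).measurableSet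
  have hcoord : (∫ x in K, x) 0 = ∫ x in K, x 0 :=
    ((EuclideanSpace.proj (𝕜 := ℝ) (0 : Fin (m + 1))).integral_comp_comm
      (continuousOn_id.integrableOn_compact hK)).symm
  have hintc : ∀ c : ℝ, IntegrableOn (fun _ => c) K volume := fun c => integrableOn_const hfin
  have hint : IntegrableOn (fun x : EuclideanSpace ℝ (Fin (m + 1)) =>
      s - {x : EuclideanSpace ℝ (Fin (m + 1)) | x 0 < s}.indicator (fun _ => s + 1) x)
      K volume := (hintc s).sub ((hintc (s + 1)).indicator hmeas)
  have hge : s * volume.real K - (s + 1) * volume.real (K ∩ {x | x 0 < s}) ≤ ∫ x in K, x 0 := by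
    calc s * volume.real K - (s + 1) * volume.real (K ∩ {x | x 0 < s})
        = ∫ x in K, (s -
            {x : EuclideanSpace ℝ (Fin (m + 1)) | x 0 < s}.indicator (fun _ => s + 1) x) := by
          rw [integral_sub (hintc s) ((hintc (s + 1)).indicator hmeas),
            setIntegral_indicator hmeas, setIntegral_const, setIntegral_const]
          simp only [smul_eq_mul]
          ring
      _ ≤ _ := by
          refine setIntegral_mono_on hint (hcont.continuousOn.integrableOn_compact hK)
            hK.measurableSet fun x hx => ?_
          by_cases h : x 0 < s
          · have := hheight x hx
            simp only [Set.indicator, Set.mem_ofPred_eq, h, if_true]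
            linarith
          · simp only [Set.indicator, Set.mem_ofPred_eq, h, if_false]
            linarith
  have hc : (centerOfMass K) 0 = (volume.real K)⁻¹ * ∫ x in K, x 0 := by
    rw [← hcoord]
    simp [centerOfMass]
  calc s - (s + 1) * ρ = (volume.real K)⁻¹ *
        (s * volume.real K - (s + 1) * (ρ * volume.real K)) := by field_simp
    _ ≤ (volume.real K)⁻¹ * ∫ x in K, x 0 := by
        refine mul_le_mul_of_nonneg_left (le_trans ?_ hge) (by positivity)
        have := mul_le_mul_of_nonneg_left hlow hs
        linarith
    _ ≤ ‖centerOfMass K‖ := by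
        rw [← hc]
        exact (le_abs_self _).trans (PiLp.norm_apply_le (centerOfMass K) 0)

/-- The coordinates of a point of `ℝᵐ⁺¹` other than the height `x 0`, as a point of `ℝᵐ`. -/
def base (x : EuclideanSpace ℝ (Fin (m + 1))) : EuclideanSpace ℝ (Fin m) :=
  WithLp.toLp 2 fun i => x i.succ

@[simp] lemma base_apply (x : EuclideanSpace ℝ (Fin (m + 1))) (i : Fin m) :
    base x i = x i.succ := rfl

lemma norm_sq_eq_height_add_base (x : EuclideanSpace ℝ (Fin (m + 1))) :
    ‖x‖ ^ 2 = x 0 ^ 2 + ‖base x‖ ^ 2 := by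
  simp [EuclideanSpace.norm_sq_eq, Fin.sum_univ_succ]

@[fun_prop] lemma continuous_base : Continuous (base (m := m)) := by
  unfold base
  fun_prop

lemma measurePreserving_height_base :
    MeasurePreserving (fun x : EuclideanSpace ℝ (Fin (m + 1)) => (x 0, base x)) := by
  have h1 := PiLp.volume_preserving_ofLp (Fin (m + 1))
  have h2 := volume_preserving_piFinSuccAbove (fun _ : Fin (m + 1) => ℝ) 0
  have h3 := (MeasurePreserving.id (volume : Measure ℝ)).prod
    (PiLp.volume_preserving_toLp (Fin m))
  exact (h3.comp h2).comp h1

/-- The set of points with height in `I` and base in `S`. -/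
def cylinder (I : Set ℝ) (S : Set (EuclideanSpace ℝ (Fin m))) :
    Set (EuclideanSpace ℝ (Fin (m + 1))) :=
  {x | x 0 ∈ I ∧ base x ∈ S}

lemma volume_cylinder {I : Set ℝ} (hI : MeasurableSet I)
    {S : Set (EuclideanSpace ℝ (Fin m))} (hS : MeasurableSet S) :
    volume (cylinder I S) = volume I * volume S := by
  have h := measurePreserving_height_base.measure_preimage
    (hI.prod hS).nullMeasurableSet
  rw [Measure.volume_eq_prod, Measure.prod_prod] at h
  exact h

lemma volume_real_cylinder {I : Set ℝ} (hI : MeasurableSet I)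
    {S : Set (EuclideanSpace ℝ (Fin m))} (hS : MeasurableSet S) :
    volume.real (cylinder I S) = volume.real I * volume.real S := by
  rw [measureReal_def, volume_cylinder hI hS, ENNReal.toReal_mul]
  rfl

lemma volume_real_coordinate_box {r : Fin m → ℝ} (hr : ∀ i, 0 ≤ r i) :
    volume.real {y : EuclideanSpace ℝ (Fin m) | ∀ i, |y i| ≤ r i} = ∏ i, (2 * r i) := by
  have h := (PiLp.volume_preserving_ofLp (Fin m)).measure_preimage
    (MeasurableSet.pi Set.countable_univ
      fun i (_ : i ∈ Set.univ) => measurableSet_Icc (a := -r i) (b := r i)).nullMeasurableSet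
  rw [volume_pi_pi] at h
  have hset : {y : EuclideanSpace ℝ (Fin m) | ∀ i, |y i| ≤ r i} =
      (WithLp.ofLp : EuclideanSpace ℝ (Fin m) → _) ⁻¹'
        Set.univ.pi fun i => Set.Icc (-r i) (r i) := by
    ext y
    simp [abs_le, Pi.le_def, forall_and]
  rw [measureReal_def, hset, h, ENNReal.toReal_prod]
  refine Finset.prod_congr rfl fun i _ => ?_
  rw [Real.volume_Icc, ENNReal.toReal_ofReal (by linarith [hr i])]
  ring

lemma measurableSet_coordinate_box (r : Fin m → ℝ) :
    MeasurableSet {y : EuclideanSpace ℝ (Fin m) | ∀ i, |y i| ≤ r i} := by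
  rw [Set.ofPred_forall]
  exact MeasurableSet.iInter fun i => (isClosed_le (by fun_prop) (by fun_prop)).measurableSet

end CenterOfMass

/-! ### The cone over a cube -/

section Cone

variable {m : ℕ}

/-- The horizontal component of the unit normals of the slanted facets of `coneOverCube m`. -/
noncomputable def coneSlope (m : ℕ) : ℝ := √(1 - 1 / ((m : ℝ) + 1) ^ 2)

lemma coneSlope_nonneg : 0 ≤ coneSlope m := Real.sqrt_nonneg _

lemma coneSlope_sq : coneSlope m ^ 2 = 1 - 1 / ((m : ℝ) + 1) ^ 2 := by
  refine Real.sq_sqrt ?_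
  rw [sub_nonneg, div_le_one (by positivity)]
  nlinarith [(Nat.cast_nonneg m : (0 : ℝ) ≤ m)]

lemma coneSlope_le_one : coneSlope m ≤ 1 := by
  refine le_of_sq_le_sq ?_ zero_le_one
  rw [coneSlope_sq]
  have : 0 ≤ 1 / ((m : ℝ) + 1) ^ 2 := by positivity
  linarith

/-- The cone with apex at height `m + 1` over an `m`-dimensional cube at height `-1`, scaled so
that each facet touches the unit ball. -/
def coneOverCube (m : ℕ) : Set (EuclideanSpace ℝ (Fin (m + 1))) :=
  {x | -1 ≤ x 0 ∧ ∀ i : Fin m, coneSlope m * |x i.succ| ≤ 1 - x 0 / (m + 1)}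

lemma height_le_of_mem_coneOverCube (hm : 1 ≤ m) {x : EuclideanSpace ℝ (Fin (m + 1))}
    (hx : x ∈ coneOverCube m) : x 0 ≤ m + 1 := by
  have h := (mul_nonneg coneSlope_nonneg (abs_nonneg _)).trans (hx.2 ⟨0, hm⟩)
  rwa [sub_nonneg, div_le_one (by positivity)] at h

lemma abs_le_two_of_mem_coneOverCube (hm : 1 ≤ m) {x : EuclideanSpace ℝ (Fin (m + 1))}
    (hx : x ∈ coneOverCube m) (i : Fin m) : |x i.succ| ≤ 2 := by
  have hm' : (1 : ℝ) ≤ m := by exact_mod_cast hm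
  have h1 : coneSlope m * |x i.succ| ≤ (m + 2) / (m + 1) := by
    refine (hx.2 i).trans ?_
    rw [le_div_iff₀ (by positivity), sub_mul, div_mul_cancel₀ _ (by positivity)]
    linarith [hx.1]
  have h2 := pow_le_pow_left₀ (mul_nonneg coneSlope_nonneg (abs_nonneg _)) h1 2
  rw [mul_pow, coneSlope_sq] at h2
  refine le_of_sq_le_sq ?_ zero_le_two
  field_simp at h2
  by_contra! h
  have h3 := mul_lt_mul_of_pos_right h (show (0 : ℝ) < m * (m + 2) by positivity)
  nlinarith

lemma isBounded_coneOverCube (hm : 1 ≤ m) : Bornology.IsBounded (coneOverCube m) := by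
  refine (Metric.isBounded_closedBall (x := 0)
    (r := √(∑ _i : Fin (m + 1), ((m : ℝ) + 2) ^ 2))).subset fun x hx => ?_
  rw [mem_closedBall_zero_iff, EuclideanSpace.norm_eq]
  refine Real.sqrt_le_sqrt (Finset.sum_le_sum fun i _ => ?_)
  refine pow_le_pow_left₀ (norm_nonneg _) ?_ 2
  rw [Real.norm_eq_abs]
  refine Fin.cases ?_ (fun j => ?_) i
  · rw [abs_le]
    have := height_le_of_mem_coneOverCube hm hx
    constructor <;> linarith [hx.1, (Nat.cast_nonneg m : (0 : ℝ) ≤ m)]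
  · linarith [abs_le_two_of_mem_coneOverCube hm hx j, (Nat.cast_nonneg m : (0 : ℝ) ≤ m)]

/-- The contact points of `coneOverCube m` with the unit ball. -/
noncomputable def contactPoint (m : ℕ) :
    Option (Fin m × Bool) → EuclideanSpace ℝ (Fin (m + 1))
  | none => EuclideanSpace.single 0 (-1)
  | some (i, true) =>
      EuclideanSpace.single 0 (1 / ((m : ℝ) + 1)) + EuclideanSpace.single i.succ (coneSlope m)
  | some (i, false) =>
      EuclideanSpace.single 0 (1 / ((m : ℝ) + 1)) + EuclideanSpace.single i.succ (-coneSlope m)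

/-- The weights with which the contact points decompose the identity. -/
noncomputable def contactWeight (m : ℕ) : Option (Fin m × Bool) → ℝ
  | none => (m + 1) / (m + 2)
  | some _ => (m + 1) ^ 2 / (2 * m * (m + 2))

lemma inner_contactPoint_none (x : EuclideanSpace ℝ (Fin (m + 1))) :
    inner ℝ (contactPoint m none) x = -x 0 := by
  simp [contactPoint, EuclideanSpace.inner_single_left]

lemma inner_contactPoint_true (i : Fin m) (x : EuclideanSpace ℝ (Fin (m + 1))) :
    inner ℝ (contactPoint m (some (i, true))) x = x 0 / (m + 1) + coneSlope m * x i.succ := by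
  simp [contactPoint, EuclideanSpace.inner_single_left, inner_add_left]
  ring

lemma inner_contactPoint_false (i : Fin m) (x : EuclideanSpace ℝ (Fin (m + 1))) :
    inner ℝ (contactPoint m (some (i, false))) x = x 0 / (m + 1) - coneSlope m * x i.succ := by
  simp [contactPoint, EuclideanSpace.inner_single_left, inner_add_left]
  ring

lemma mem_coneOverCube_iff {x : EuclideanSpace ℝ (Fin (m + 1))} :
    x ∈ coneOverCube m ↔ ∀ k, inner ℝ (contactPoint m k) x ≤ 1 := by
  simp only [coneOverCube, Set.mem_ofPred_eq, Option.forall, Prod.forall, Bool.forall_bool,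
    inner_contactPoint_none, inner_contactPoint_true, inner_contactPoint_false]
  refine and_congr (by constructor <;> intro h <;> linarith) (forall_congr' fun i => ?_)
  rw [← abs_of_nonneg (coneSlope_nonneg (m := m)), ← abs_mul, abs_le,
    abs_of_nonneg (coneSlope_nonneg (m := m))]
  constructor <;> rintro ⟨h1, h2⟩ <;> constructor <;> linarith

lemma norm_contactPoint (k : Option (Fin m × Bool)) : ‖contactPoint m k‖ = 1 := by
  have h : ‖contactPoint m k‖ ^ 2 = 1 := by
    rw [← real_inner_self_eq_norm_sq]
    obtain _ | ⟨i, _ | _⟩ := k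
    · rw [inner_contactPoint_none]
      simp [contactPoint]
    · rw [inner_contactPoint_false]
      have := coneSlope_sq (m := m)
      simp [contactPoint, Fin.succ_ne_zero, (Fin.succ_ne_zero _).symm]
      field_simp at this ⊢
      linarith
    · rw [inner_contactPoint_true]
      have := coneSlope_sq (m := m)
      simp [contactPoint, Fin.succ_ne_zero, (Fin.succ_ne_zero _).symm]
      field_simp at this ⊢
      linarith
  exact (pow_eq_one_iff_of_nonneg (norm_nonneg _) two_ne_zero).1 h

lemma sum_contactWeight_smul (hm : 1 ≤ m) : ∑ k, contactWeight m k • contactPoint m k = 0 := by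
  have hm' : (1 : ℝ) ≤ m := by exact_mod_cast hm
  refine ext_inner_right ℝ fun x => ?_
  rw [sum_inner, inner_zero_left]
  simp_rw [inner_smul_left]
  simp [Fintype.sum_option, Fintype.sum_prod_type, inner_contactPoint_none,
    inner_contactPoint_true, inner_contactPoint_false, contactWeight, ← mul_add]
  field_simp
  ring

lemma sum_contactWeight_mul_sq (hm : 1 ≤ m) (x : EuclideanSpace ℝ (Fin (m + 1))) :
    ∑ k, contactWeight m k * inner ℝ (contactPoint m k) x ^ 2 = ‖x‖ ^ 2 := by
  have hm' : (1 : ℝ) ≤ m := by exact_mod_cast hm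
  have h : ∀ i : Fin m,
      (x 0 / (m + 1) + coneSlope m * x i.succ) ^ 2 + (x 0 / (m + 1) - coneSlope m * x i.succ) ^ 2
        = 2 * (x 0 / (m + 1)) ^ 2 + 2 * (m * (m + 2) / (m + 1) ^ 2) * x i.succ ^ 2 := by
    intro i
    have h1 : coneSlope m ^ 2 = m * (m + 2) / (m + 1) ^ 2 := by
      rw [coneSlope_sq]
      field_simp
      ring
    rw [← h1]
    ring
  simp only [Fintype.sum_option, Fintype.sum_prod_type,
    Fintype.sum_bool, inner_contactPoint_none, inner_contactPoint_true, inner_contactPoint_false,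
    contactWeight, h, ← Finset.mul_sum, Finset.sum_add_distrib,
    EuclideanSpace.norm_sq_eq, Fin.sum_univ_succ, Real.norm_eq_abs, sq_abs]
  simp
  field_simp
  ring

lemma isClosed_coneOverCube : IsClosed (coneOverCube m) := by
  have : coneOverCube m = {x | ∀ k, inner ℝ (contactPoint m k) x ≤ 1} := by
    ext x
    exact mem_coneOverCube_iff
  rw [this, Set.ofPred_forall]
  exact isClosed_iInter fun k => isClosed_le (by fun_prop) continuous_const

lemma convex_coneOverCube : Convex ℝ (coneOverCube m) := by
  have : coneOverCube m = {x | ∀ k, inner ℝ (contactPoint m k) x ≤ 1} := by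
    ext x
    exact mem_coneOverCube_iff
  rw [this, Set.ofPred_forall]
  exact convex_iInter fun i => convex_halfSpace_le (innerₛₗ ℝ (contactPoint m i)).isLinear _

lemma closedBall_subset_coneOverCube : Metric.closedBall 0 1 ⊆ coneOverCube m := by
  intro x hx
  rw [mem_closedBall_zero_iff] at hx
  refine mem_coneOverCube_iff.2 fun k => (real_inner_le_norm _ _).trans ?_
  rwa [norm_contactPoint, one_mul]

theorem inJohnPosition_of_subset_coneOverCube (hm : 1 ≤ m)
    {K : Set (EuclideanSpace ℝ (Fin (m + 1)))} (hball : Metric.closedBall 0 1 ⊆ K)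
    (hK : K ⊆ coneOverCube m) : InJohnPosition K := by
  refine inJohnPosition_of_contact_points (w := contactWeight m) (fun k => ?_) norm_contactPoint
    (sum_contactWeight_smul hm) (sum_contactWeight_mul_sq hm) hball
    fun x hx => mem_coneOverCube_iff.1 (hK hx)
  cases k <;> simp only [contactWeight] <;> positivity

end Cone

lemma isConvexBody_of_closedBall_subset {n : ℕ} {K : Set (EuclideanSpace ℝ (Fin n))}
    (hconv : Convex ℝ K) (hclosed : IsClosed K) (hbdd : Bornology.IsBounded K)
    (hball : Metric.closedBall 0 1 ⊆ K) : IsConvexBody K :=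
  ⟨hconv, Metric.isCompact_of_isClosed_isBounded hclosed hbdd,
    ⟨0, mem_interior_iff_mem_nhds.2
      (Filter.mem_of_superset (Metric.closedBall_mem_nhds 0 one_pos) hball)⟩⟩

/-! ### Truncating the cone by a slowly growing ball -/

section Ball

variable {m : ℕ}

lemma volume_real_closedBall_eq (x : EuclideanSpace ℝ (Fin m)) {r : ℝ} (hr : 0 ≤ r) :
    volume.real (Metric.closedBall x r) =
      r ^ m * volume.real (Metric.closedBall (0 : EuclideanSpace ℝ (Fin m)) 1) := by
  rw [Measure.addHaar_real_closedBall' _ _ hr, finrank_euclideanSpace_fin]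

lemma volume_real_closedBall_pos (x : EuclideanSpace ℝ (Fin m)) {r : ℝ} (hr : 0 < r) :
    0 < volume.real (Metric.closedBall x r) :=
  ENNReal.toReal_pos (Metric.measure_closedBall_pos _ _ hr).ne' measure_closedBall_lt_top.ne

/-- A cap of a ball is contained in a smaller ball centered at the middle of its flat side. -/
lemma volume_real_cap_le {R δ σ : ℝ} (hR : 0 ≤ R) (hδ : 0 ≤ δ) (hσ : σ ^ 2 = 1) (i : Fin m) :
    volume.real (Metric.closedBall (0 : EuclideanSpace ℝ (Fin m)) R ∩ {y | δ * R ≤ σ * y i}) ≤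
      Real.exp (-(m * δ ^ 2 / 2)) *
        volume.real (Metric.closedBall (0 : EuclideanSpace ℝ (Fin m)) R) := by
  have hsub : Metric.closedBall (0 : EuclideanSpace ℝ (Fin m)) R ∩ {y | δ * R ≤ σ * y i} ⊆
      Metric.closedBall (EuclideanSpace.single i (σ * δ * R))
        (Real.exp (-(δ ^ 2 / 2)) * R) := by
    rintro y ⟨hy, hyi⟩
    rw [mem_closedBall_zero_iff] at hy
    rw [Set.mem_ofPred_eq] at hyi
    rw [mem_closedBall_iff_norm]
    refine le_of_sq_le_sq ?_ (by positivity)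
    have hexp : Real.exp (-(δ ^ 2 / 2)) ^ 2 = Real.exp (-δ ^ 2) := by
      rw [← Real.exp_nat_mul]
      congr 1
      push_cast
      ring
    rw [norm_sub_sq_real, EuclideanSpace.inner_single_right, mul_pow, hexp]
    simp only [PiLp.norm_single, Real.norm_eq_abs, sq_abs, conj_trivial]
    have h1 : ‖y‖ ^ 2 ≤ R ^ 2 := pow_le_pow_left₀ (norm_nonneg _) hy 2
    have h2 : δ * R * (δ * R) ≤ δ * R * (σ * y i) := mul_le_mul_of_nonneg_left hyi (by positivity)
    have h3 : (1 - δ ^ 2) * R ^ 2 ≤ Real.exp (-δ ^ 2) * R ^ 2 :=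
      mul_le_mul_of_nonneg_right (by linarith [Real.add_one_le_exp (-δ ^ 2)]) (by positivity)
    have h4 : (σ * δ * R) ^ 2 = δ ^ 2 * R ^ 2 := by
      rw [mul_pow, mul_pow, hσ, one_mul]
    rw [h4]
    linarith
  refine (measureReal_mono hsub measure_closedBall_lt_top.ne).trans_eq ?_
  rw [volume_real_closedBall_eq _ (by positivity), volume_real_closedBall_eq _ hR, mul_pow,
    ← Real.exp_nat_mul, ← mul_assoc]
  congr 3
  ring

/-- Most of a high-dimensional ball lies in a small cube. -/
lemma half_volume_closedBall_le {R δ : ℝ} (hm : 1 ≤ m) (hR : 0 ≤ R) (hδ : 0 ≤ δ)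
    (hexp : Real.exp (-(m * δ ^ 2 / 2)) ≤ 1 / (4 * m)) :
    1 / 2 * volume.real (Metric.closedBall (0 : EuclideanSpace ℝ (Fin m)) R) ≤
      volume.real (Metric.closedBall (0 : EuclideanSpace ℝ (Fin m)) R ∩
        {y | ∀ i, |y i| ≤ δ * R}) := by
  have hm' : (0 : ℝ) < m := by exact_mod_cast hm
  set B := Metric.closedBall (0 : EuclideanSpace ℝ (Fin m)) R
  have hBfin : volume B ≠ ⊤ := measure_closedBall_lt_top.ne
  have hcover : B ⊆ (B ∩ {y | ∀ i, |y i| ≤ δ * R}) ∪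
      ⋃ i : Fin m, ((B ∩ {y | δ * R ≤ 1 * y i}) ∪ (B ∩ {y | δ * R ≤ -1 * y i})) := by
    intro y hy
    by_cases h : ∀ i, |y i| ≤ δ * R
    · exact Or.inl ⟨hy, h⟩
    · push Not at h
      obtain ⟨i, hi⟩ := h
      refine Or.inr (Set.mem_iUnion.2 ⟨i, ?_⟩)
      rcases lt_abs.1 hi with h | h
      · exact Or.inl ⟨hy, by simpa using h.le⟩
      · exact Or.inr ⟨hy, by simpa using h.le⟩
  have hfin : ∀ s, volume (B ∩ s) ≠ ⊤ := fun s =>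
    ((measure_mono Set.inter_subset_left).trans_lt hBfin.lt_top).ne
  have hunion : volume.real (⋃ i : Fin m, ((B ∩ {y | δ * R ≤ 1 * y i}) ∪
      (B ∩ {y | δ * R ≤ -1 * y i}))) ≤ 1 / 2 * volume.real B := by
    calc _ ≤ ∑ i : Fin m, volume.real ((B ∩ {y | δ * R ≤ 1 * y i}) ∪
          (B ∩ {y | δ * R ≤ -1 * y i})) := measureReal_iUnion_fintype_le _
      _ ≤ ∑ _i : Fin m, (1 / (4 * m) * volume.real B + 1 / (4 * m) * volume.real B) := by
          refine Finset.sum_le_sum fun i _ => (measureReal_union_le _ _).trans ?_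
          gcongr
          · exact (volume_real_cap_le hR hδ (by norm_num) i).trans
              (mul_le_mul_of_nonneg_right hexp measureReal_nonneg)
          · exact (volume_real_cap_le hR hδ (by norm_num) i).trans
              (mul_le_mul_of_nonneg_right hexp measureReal_nonneg)
      _ = _ := by
          simp only [Finset.sum_const, Finset.card_univ, Fintype.card_fin, nsmul_eq_mul]
          field_simp
          ring
  have hsub : (⋃ i : Fin m, ((B ∩ {y | δ * R ≤ 1 * y i}) ∪ (B ∩ {y | δ * R ≤ -1 * y i}))) ⊆ B :=
    Set.iUnion_subset fun i => Set.union_subset Set.inter_subset_left Set.inter_subset_left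
  have htot := (measureReal_mono hcover (measure_union_ne_top (hfin _)
    ((measure_mono hsub).trans_lt hBfin.lt_top).ne)).trans (measureReal_union_le _ _)
  linarith

/-- The part of the cone over the cube whose horizontal sections lie in balls of radius growing
from `1` at the bottom to about `2` near the apex. -/
def ballTruncatedCone (m : ℕ) : Set (EuclideanSpace ℝ (Fin (m + 1))) :=
  coneOverCube m ∩ {x | ‖base x‖ ≤ 1 + (1 + x 0) / (m + 1)}

lemma closedBall_subset_ballTruncatedCone : Metric.closedBall 0 1 ⊆ ballTruncatedCone m := by
  intro x hx
  refine ⟨closedBall_subset_coneOverCube hx, ?_⟩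
  have h0 := (closedBall_subset_coneOverCube hx).1
  rw [mem_closedBall_zero_iff] at hx
  have h1 : ‖base x‖ ≤ 1 := by
    refine le_of_sq_le_sq ?_ zero_le_one
    nlinarith [norm_sq_eq_height_add_base x, sq_nonneg (x 0), norm_nonneg x]
  have h2 : 0 ≤ (1 + x 0) / (m + 1) := div_nonneg (by linarith) (by positivity)
  rw [Set.mem_ofPred_eq]
  linarith

lemma isConvexBody_ballTruncatedCone (hm : 1 ≤ m) : IsConvexBody (ballTruncatedCone m) := by
  refine isConvexBody_of_closedBall_subset (convex_coneOverCube.inter ?_)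
    (isClosed_coneOverCube.inter (isClosed_le (by fun_prop) (by fun_prop)))
    ((isBounded_coneOverCube hm).subset Set.inter_subset_left) closedBall_subset_ballTruncatedCone
  intro x hx y hy a b ha hb hab
  rw [Set.mem_ofPred_eq] at hx hy ⊢
  have h : base (a • x + b • y) = a • base x + b • base y := by
    ext i
    simp
  rw [h]
  refine (norm_add_le _ _).trans ?_
  rw [norm_smul_of_nonneg ha, norm_smul_of_nonneg hb]
  calc a * ‖base x‖ + b * ‖base y‖
      ≤ a * (1 + (1 + x 0) / (m + 1)) + b * (1 + (1 + y 0) / (m + 1)) := by gcongr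
    _ = (a + b) + ((a + b) + (a * x 0 + b * y 0)) / (m + 1) := by ring
    _ = _ := by
      rw [hab]
      simp

/-- The volume below height `(1 - 4δ)(m + 1)` is compared with that between heights
`(1 - 3δ)(m + 1)` and `(1 - 2δ)(m + 1)`, where the sections of the cone are cubes of half-width at
least `2δ`, so that they contain most of any concentric ball of radius at most `2`. -/
lemma le_norm_centerOfMass_ballTruncatedCone (hm : 1 ≤ m) {δ : ℝ} (hδ : 0 < δ) (hδ4 : 4 * δ ≤ 1)
    (hmδ : 1 / 2 ≤ m * δ ^ 2) (hexp : Real.exp (-(m * δ ^ 2 / 2)) ≤ 1 / (4 * m)) :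
    (1 - 5 * δ) * (m + 1) ≤ ‖centerOfMass (ballTruncatedCone m)‖ := by
  have hm' : (1 : ℝ) ≤ m := by exact_mod_cast hm
  set K := ballTruncatedCone m
  have hK : IsCompact K := (isConvexBody_ballTruncatedCone hm).isCompact
  obtain ⟨n, hn⟩ : ∃ n : ℝ, n = m + 1 := ⟨_, rfl⟩
  have hn0 : 0 < n := by linarith
  have hδn : 1 ≤ 3 * δ * n := by nlinarith
  have hδn' : 1 / n ≤ 3 * δ := by rwa [div_le_iff₀ hn0]
  have hinv : 0 < 1 / n := by positivity
  set R₁ := 2 - 4 * δ + 1 / n with hR₁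
  set R₂ := 2 - 3 * δ + 1 / n with hR₂
  have hR₁0 : 0 ≤ R₁ := by linarith
  have hR₂0 : 0 < R₂ := by linarith
  -- the volume of the sections grows geometrically with the height
  have hgrowth : R₁ ^ m ≤ δ ^ 2 / 2 * R₂ ^ m := by
    have h1 : R₁ ≤ Real.exp (-(δ / 2)) * R₂ := by
      have := Real.add_one_le_exp (-(δ / 2))
      calc R₁ ≤ (-(δ / 2) + 1) * R₂ := by nlinarith
        _ ≤ _ := by gcongr
    calc R₁ ^ m ≤ (Real.exp (-(δ / 2)) * R₂) ^ m := pow_le_pow_left₀ hR₁0 h1 m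
      _ = Real.exp (-(m * δ / 2)) * R₂ ^ m := by
          rw [mul_pow, ← Real.exp_nat_mul]
          congr 2
          ring
      _ ≤ δ ^ 2 / 2 * R₂ ^ m := by
          refine mul_le_mul_of_nonneg_right ?_ (by positivity)
          calc Real.exp (-(m * δ / 2)) ≤ Real.exp (-(m * δ ^ 2 / 2)) := by
                refine Real.exp_le_exp.2 ?_
                have : m * δ ^ 2 ≤ m * δ := by
                  refine mul_le_mul_of_nonneg_left ?_ (by positivity)
                  nlinarith
                linarith
            _ ≤ 1 / (4 * m) := hexp
            _ ≤ δ ^ 2 / 2 := by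
                rw [div_le_div_iff₀ (by positivity) two_pos]
                linarith
  set ω := volume.real (Metric.closedBall (0 : EuclideanSpace ℝ (Fin m)) 1)
  have hω : 0 < ω := volume_real_closedBall_pos _ one_pos
  have hlow : volume.real (K ∩ {x | x 0 < n * (1 - 4 * δ)}) ≤ n * (R₁ ^ m * ω) := by
    have hsub : K ∩ {x | x 0 < n * (1 - 4 * δ)} ⊆
        cylinder (Set.Icc (-1) (n * (1 - 4 * δ))) (Metric.closedBall 0 R₁) := by
      rintro x ⟨⟨hx, hxb⟩, hxs⟩
      rw [Set.mem_ofPred_eq] at hxs hxb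
      refine ⟨⟨hx.1, hxs.le⟩, mem_closedBall_zero_iff.2 (hxb.trans ?_)⟩
      rw [← hn, hR₁]
      calc 1 + (1 + x 0) / n ≤ 1 + (1 + n * (1 - 4 * δ)) / n := by gcongr
        _ = _ := by
          field_simp
          ring
    have hvol := volume_real_cylinder (measurableSet_Icc (a := (-1 : ℝ)) (b := n * (1 - 4 * δ)))
      (Metric.isClosed_closedBall (x := (0 : EuclideanSpace ℝ (Fin m))) (ε := R₁)).measurableSet
    rw [Real.volume_real_Icc_of_le (by nlinarith), volume_real_closedBall_eq _ hR₁0] at hvol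
    have hfin : volume (cylinder (Set.Icc (-1) (n * (1 - 4 * δ)))
        (Metric.closedBall (0 : EuclideanSpace ℝ (Fin m)) R₁)) ≠ ⊤ := by
      rw [volume_cylinder measurableSet_Icc Metric.isClosed_closedBall.measurableSet]
      exact ENNReal.mul_ne_top measure_Icc_lt_top.ne measure_closedBall_lt_top.ne
    refine (measureReal_mono hsub hfin).trans ?_
    rw [hvol]
    exact mul_le_mul_of_nonneg_right (by nlinarith) (by positivity)
  have hhigh : n * δ * (1 / 2 * (R₂ ^ m * ω)) ≤ volume.real K := by
    have hsub : cylinder (Set.Icc (n * (1 - 3 * δ)) (n * (1 - 2 * δ)))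
        (Metric.closedBall 0 R₂ ∩ {y | ∀ i, |y i| ≤ δ * R₂}) ⊆ K := by
      rintro x ⟨⟨hx1, hx2⟩, hxb, hxc⟩
      rw [mem_closedBall_zero_iff] at hxb
      rw [Set.mem_ofPred_eq] at hxc
      refine ⟨⟨by nlinarith, fun i => ?_⟩, hxb.trans ?_⟩
      · rw [← hn]
        calc coneSlope m * |x i.succ| ≤ 1 * (δ * R₂) :=
              mul_le_mul coneSlope_le_one (hxc i) (abs_nonneg _) zero_le_one
          _ ≤ 2 * δ := by nlinarith
          _ = 1 - n * (1 - 2 * δ) / n := by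
              field_simp
              ring
          _ ≤ _ := by gcongr
      · rw [← hn, hR₂]
        calc 2 - 3 * δ + 1 / n = 1 + (1 + n * (1 - 3 * δ)) / n := by
              field_simp
              ring
          _ ≤ _ := by gcongr
    refine le_trans ?_ (measureReal_mono hsub hK.measure_lt_top.ne)
    rw [volume_real_cylinder measurableSet_Icc
      (Metric.isClosed_closedBall.measurableSet.inter (measurableSet_coordinate_box _)),
      Real.volume_real_Icc_of_le (by nlinarith), ← volume_real_closedBall_eq 0 hR₂0.le]
    have h := half_volume_closedBall_le hm hR₂0.le hδ.le hexp
    calc _ ≤ n * δ * _ := mul_le_mul_of_nonneg_left h (by positivity)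
      _ = _ := by ring
  have hpos : 0 < volume.real K := lt_of_lt_of_le (by positivity) hhigh
  have hmain := le_norm_centerOfMass hK hpos (fun x hx => hx.1.1) (s := n * (1 - 4 * δ)) (ρ := δ)
    (by nlinarith) (by
      refine hlow.trans ?_
      calc n * (R₁ ^ m * ω) ≤ n * (δ ^ 2 / 2 * R₂ ^ m * ω) := by gcongr
        _ = δ * (n * δ * (1 / 2 * (R₂ ^ m * ω))) := by ring
        _ ≤ δ * volume.real K := by gcongr)
  rw [← hn]
  refine le_trans ?_ hmain
  nlinarith

end Ball

/-! ### Truncating the cone by inequalities on pairs of coordinates -/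

section Pairs

variable {m : ℕ}

/-- The part of the cone over the cube where `|yᵢ| + |yⱼ|` is bounded, for each pair of distinct
base coordinates, by a slowly growing affine function of the height. The bound is at least
`3 / 2 ≥ √2`, so the unit ball is kept; it reaches `9 / 5`, twice the half-width of the sections of
the cone at height `(m + 1) / 10`, before height `(m + 1) / 20`. -/
def pairTruncatedCone (m : ℕ) : Set (EuclideanSpace ℝ (Fin (m + 1))) :=
  coneOverCube m ∩ {x | ∀ i j : Fin m, i ≠ j →
    |x i.succ| + |x j.succ| ≤ 3 / 2 * (1 + 4 * (1 + x 0) / (m + 1))}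

/-- The inequalities that define `pairTruncatedCone m`: those of the cone, and one for each pair of
distinct base coordinates and each choice of signs. -/
abbrev PairIndex (m : ℕ) : Type :=
  Option (Fin m × Bool) ⊕ ({p : Fin m × Fin m // p.1 ≠ p.2} × Bool × Bool)

lemma card_pairIndex_le : Fintype.card (PairIndex m) ≤ 4 * (m + 1) ^ 2 := by
  have h : Fintype.card {p : Fin m × Fin m // p.1 ≠ p.2} ≤ m * m := by
    refine (Fintype.card_subtype_le _).trans ?_
    simp
  simp only [PairIndex, Fintype.card_sum, Fintype.card_option, Fintype.card_prod, Fintype.card_fin,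
    Fintype.card_bool]
  nlinarith

/-- `1` or `-1`. -/
def boolSign (σ : Bool) : ℝ := if σ then 1 else -1

lemma abs_add_abs_le_iff {a b c : ℝ} :
    |a| + |b| ≤ c ↔ ∀ σ τ, boolSign σ * a + boolSign τ * b ≤ c := by
  simp only [boolSign, Bool.forall_bool]
  constructor
  · intro h
    have := le_abs_self a
    have := le_abs_self b
    have := neg_abs_le a
    have := neg_abs_le b
    refine ⟨⟨?_, ?_⟩, ?_, ?_⟩ <;> norm_num <;> linarith
  · rintro ⟨⟨h1, h2⟩, h3, h4⟩
    norm_num at h1 h2 h3 h4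
    rcases abs_cases a with ⟨ha, _⟩ | ⟨ha, _⟩ <;> rcases abs_cases b with ⟨hb, _⟩ | ⟨hb, _⟩ <;>
      rw [ha, hb] <;> linarith

/-- Outer normals of the half-spaces that define `pairTruncatedCone m`. -/
noncomputable def pairNormal (m : ℕ) : PairIndex m → EuclideanSpace ℝ (Fin (m + 1))
  | .inl k => contactPoint m k
  | .inr (p, σ, τ) => EuclideanSpace.single 0 (-6 / ((m : ℝ) + 1)) +
      EuclideanSpace.single p.1.1.succ (boolSign σ) + EuclideanSpace.single p.1.2.succ (boolSign τ)

/-- Right-hand sides of the inequalities that define `pairTruncatedCone m`. -/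
noncomputable def pairBound (m : ℕ) : PairIndex m → ℝ
  | .inl _ => 1
  | .inr _ => 3 / 2 * (1 + 4 / (m + 1))

lemma pairNormal_ne_zero (k : PairIndex m) : pairNormal m k ≠ 0 := by
  obtain k | ⟨p, σ, τ⟩ := k
  · intro h
    have := norm_contactPoint (m := m) k
    simp [show contactPoint m k = 0 from h] at this
  · intro h
    have h0 : (-6 / ((m : ℝ) + 1)) = 0 := by
      simpa [pairNormal, (Fin.succ_ne_zero _).symm] using
        congrArg (fun x : EuclideanSpace ℝ (Fin (m + 1)) => x 0) h
    have : (-6 / ((m : ℝ) + 1)) < 0 := div_neg_of_neg_of_pos (by norm_num) (by positivity)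
    linarith

lemma pairTruncatedCone_eq :
    pairTruncatedCone m = {x | ∀ k, inner ℝ (pairNormal m k) x ≤ pairBound m k} := by
  ext x
  rw [Set.mem_ofPred_eq, Sum.forall]
  refine and_congr mem_coneOverCube_iff ?_
  simp only [Prod.forall, Subtype.forall]
  refine forall_congr' fun i => forall_congr' fun j => forall_congr' fun _ => ?_
  rw [abs_add_abs_le_iff]
  refine forall_congr' fun σ => forall_congr' fun τ => ?_
  simp only [pairNormal, pairBound, inner_add_left, EuclideanSpace.inner_single_left, conj_trivial]
  have h : 3 / 2 * (1 + 4 * (1 + x 0) / (m + 1)) =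
      3 / 2 * (1 + 4 / (m + 1)) - -6 / ((m : ℝ) + 1) * x 0 := by ring
  rw [h]
  constructor <;> intro h <;> linarith

lemma closedBall_subset_pairTruncatedCone : Metric.closedBall 0 1 ⊆ pairTruncatedCone m := by
  intro x hx
  refine ⟨closedBall_subset_coneOverCube hx, fun i j hij => ?_⟩
  have h0 := (closedBall_subset_coneOverCube hx).1
  rw [mem_closedBall_zero_iff] at hx
  have h2 : 0 ≤ 4 * (1 + x 0) / (m + 1) := div_nonneg (by linarith) (by positivity)
  have h1 : |x i.succ| ^ 2 + |x j.succ| ^ 2 ≤ 1 := by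
    have h3 : ∑ k ∈ {i.succ, j.succ}, ‖x k‖ ^ 2 ≤ ‖x‖ ^ 2 := by
      rw [EuclideanSpace.norm_sq_eq]
      exact Finset.sum_le_sum_of_subset_of_nonneg (Finset.subset_univ _) fun _ _ _ => by positivity
    rw [Finset.sum_pair (by simpa using hij)] at h3
    simp only [Real.norm_eq_abs] at h3
    nlinarith [norm_nonneg x]
  nlinarith [sq_nonneg (|x i.succ| - |x j.succ|), abs_nonneg (x i.succ), abs_nonneg (x j.succ)]

lemma isConvexBody_pairTruncatedCone (hm : 1 ≤ m) : IsConvexBody (pairTruncatedCone m) := by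
  refine isConvexBody_of_closedBall_subset ?_ ?_
    ((isBounded_coneOverCube hm).subset Set.inter_subset_left) closedBall_subset_pairTruncatedCone
  · rw [pairTruncatedCone_eq, Set.ofPred_forall]
    exact convex_iInter fun k => convex_halfSpace_le (innerₛₗ ℝ (pairNormal m k)).isLinear _
  · rw [pairTruncatedCone_eq, Set.ofPred_forall]
    exact isClosed_iInter fun k => isClosed_le (by fun_prop) continuous_const

lemma isPolytope_pairTruncatedCone (hm : 1 ≤ m) : IsPolytope (pairTruncatedCone m) := by
  have h : Bornology.IsBounded (pairTruncatedCone m) :=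
    (isBounded_coneOverCube hm).subset Set.inter_subset_left
  rw [pairTruncatedCone_eq] at h ⊢
  exact isPolytope_setOf_forall_inner_le h

lemma facets_pairTruncatedCone (hm : 1 ≤ m) : (facets (pairTruncatedCone m)).Finite ∧
    (facets (pairTruncatedCone m)).ncard ≤ 4 * (m + 1) ^ 2 := by
  have hint := (isConvexBody_pairTruncatedCone hm).interior_nonempty
  rw [pairTruncatedCone_eq] at hint ⊢
  obtain ⟨h1, h2⟩ := facets_finite_and_ncard_le pairNormal_ne_zero hint
  exact ⟨h1, h2.trans card_pairIndex_le⟩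

/-- The low part of the truncated cone is covered by `m` thin boxes, as at most one base coordinate
exceeds half the bound on the sums of pairs. -/
lemma volume_real_low_pairTruncatedCone_le (hm : 120 ≤ m) :
    volume.real (pairTruncatedCone m ∩ {x | x 0 < (m + 1) / 40}) ≤
      m * (((m + 1) / 40 + 1) * (4 * (17 / 10) ^ (m - 1))) := by
  have hm' : (120 : ℝ) ≤ m := by exact_mod_cast hm
  let r : Fin m → Fin m → ℝ := fun i j => if j = i then 2 else 17 / 20
  have hr : ∀ i j, 0 ≤ r i j := by
    intro i j
    simp only [r]
    split_ifs <;> norm_num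
  have hsub : pairTruncatedCone m ∩ {x | x 0 < (m + 1) / 40} ⊆
      ⋃ i, cylinder (Set.Icc (-1) (((m : ℝ) + 1) / 40)) {y | ∀ j, |y j| ≤ r i j} := by
    rintro x ⟨⟨hx, hxp⟩, hxs⟩
    rw [Set.mem_ofPred_eq] at hxs hxp
    have hbound : 3 / 2 * (1 + 4 * (1 + x 0) / (m + 1)) ≤ 17 / 10 := by
      have : 4 * (1 + x 0) / (m + 1) ≤ 2 / 15 := by
        rw [div_le_iff₀ (by positivity)]
        linarith
      linarith
    rw [Set.mem_iUnion]
    by_cases h : ∃ i : Fin m, 17 / 20 < |x i.succ|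
    · obtain ⟨i, hi⟩ := h
      refine ⟨i, ⟨hx.1, hxs.le⟩, fun j => ?_⟩
      by_cases hji : j = i
      · simpa [r, hji] using abs_le_two_of_mem_coneOverCube (by omega) hx i
      · have := hxp i j (Ne.symm hji)
        simp only [r, hji, if_false, base_apply]
        linarith
    · push Not at h
      refine ⟨⟨0, by omega⟩, ⟨hx.1, hxs.le⟩, fun j => (h j).trans ?_⟩
      simp only [r]
      split_ifs <;> norm_num
  have hvol : ∀ i, volume.real (cylinder (Set.Icc (-1) (((m : ℝ) + 1) / 40))
      {y | ∀ j, |y j| ≤ r i j}) = ((m + 1) / 40 + 1) * (4 * (17 / 10) ^ (m - 1)) := by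
    intro i
    rw [volume_real_cylinder measurableSet_Icc (measurableSet_coordinate_box _),
      volume_real_coordinate_box (hr i), Real.volume_real_Icc_of_le (by linarith),
      ← Finset.mul_prod_erase _ _ (Finset.mem_univ i)]
    have : ∀ j ∈ Finset.univ.erase i, 2 * r i j = 17 / 10 := by
      intro j hj
      simp only [r, Finset.ne_of_mem_erase hj, if_false]
      norm_num
    rw [Finset.prod_congr rfl this, Finset.prod_const, Finset.card_erase_of_mem (Finset.mem_univ i),
      Finset.card_univ, Fintype.card_fin]
    simp only [r, if_true]
    ring
  have hfin : volume (⋃ i, cylinder (Set.Icc (-1) (((m : ℝ) + 1) / 40))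
      {y | ∀ j, |y j| ≤ r i j}) ≠ ⊤ := by
    refine ((measure_iUnion_le _).trans_lt ?_).ne
    rw [tsum_fintype]
    refine ENNReal.sum_lt_top.2 fun i _ => ?_
    refine lt_top_iff_ne_top.2 fun h => ?_
    have := hvol i
    rw [measureReal_def, h, ENNReal.toReal_top] at this
    have hpos : 0 < (((m : ℝ) + 1) / 40 + 1) * (4 * (17 / 10) ^ (m - 1)) := by positivity
    exact hpos.ne this
  refine (measureReal_mono hsub hfin).trans ((measureReal_iUnion_fintype_le _).trans_eq ?_)
  simp only [hvol, Finset.sum_const, Finset.card_univ, Fintype.card_fin, nsmul_eq_mul]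

/-- The truncation does not cut the cone above height `(m + 1) / 20`. -/
lemma le_volume_real_pairTruncatedCone (hm : 1 ≤ m) :
    ((m : ℝ) + 1) / 20 * (9 / 5) ^ m ≤ volume.real (pairTruncatedCone m) := by
  have hsub : cylinder (Set.Icc (((m : ℝ) + 1) / 20) ((m + 1) / 10))
      {y | ∀ i : Fin m, |y i| ≤ 9 / 10} ⊆ pairTruncatedCone m := by
    rintro x ⟨⟨hx1, hx2⟩, hxb⟩
    have hb : ∀ i : Fin m, |x i.succ| ≤ 9 / 10 := hxb
    refine ⟨⟨by linarith [(by positivity : 0 ≤ ((m : ℝ) + 1) / 20)], fun i => ?_⟩,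
      fun i j _ => ?_⟩
    · have h1 : coneSlope m * |x i.succ| ≤ 1 * (9 / 10) :=
        mul_le_mul coneSlope_le_one (hb i) (abs_nonneg _) zero_le_one
      have h2 : x 0 / (m + 1) ≤ 1 / 10 := by
        rw [div_le_iff₀ (by positivity)]
        linarith
      linarith
    · have h2 : 1 / 5 ≤ 4 * (1 + x 0) / (m + 1) := by
        rw [le_div_iff₀ (by positivity)]
        linarith
      linarith [hb i, hb j]
  refine le_trans (le_of_eq ?_) (measureReal_mono hsub
    (isConvexBody_pairTruncatedCone hm).isCompact.measure_lt_top.ne)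
  rw [volume_real_cylinder measurableSet_Icc (measurableSet_coordinate_box _),
    volume_real_coordinate_box (fun _ => by norm_num),
    Real.volume_real_Icc_of_le (by
      have : 0 ≤ (m : ℝ) + 1 := by positivity
      linarith), Finset.prod_const, Finset.card_univ, Fintype.card_fin]
  congr 1
  · ring
  · norm_num

lemma le_norm_centerOfMass_pairTruncatedCone (hm : 120 ≤ m)
    (hgrowth : (16 : ℝ) * m * (17 / 10) ^ (m - 1) ≤ (9 / 5) ^ m) :
    ((m : ℝ) + 1) / 80 ≤ ‖centerOfMass (pairTruncatedCone m)‖ := by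
  have hm' : (120 : ℝ) ≤ m := by exact_mod_cast hm
  have hhigh := le_volume_real_pairTruncatedCone (m := m) (by omega)
  have hmain := le_norm_centerOfMass (isConvexBody_pairTruncatedCone (m := m) (by omega)).isCompact
    (lt_of_lt_of_le (by positivity) hhigh) (fun x hx => hx.1.1) (s := (m + 1) / 40) (ρ := 1 / 4)
    (by positivity) (by
      refine (volume_real_low_pairTruncatedCone_le hm).trans ?_
      calc m * (((m + 1) / 40 + 1) * (4 * (17 / 10 : ℝ) ^ (m - 1)))
          = 1 / 4 * (((m + 1) / 40 + 1) * (16 * m * (17 / 10 : ℝ) ^ (m - 1))) := by ring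
        _ ≤ 1 / 4 * (((m : ℝ) + 1) / 20 * (9 / 5) ^ m) := by
            gcongr
            linarith
        _ ≤ _ := by gcongr)
  linarith

end Pairs

/-! ### Conclusion -/

lemma notMem_dilate_closedBall {n : ℕ} {x : EuclideanSpace ℝ (Fin n)} {r : ℝ} (hr : 0 ≤ r)
    (hx : r < ‖x‖) : x ∉ dilate 0 r (Metric.closedBall 0 1) := by
  rintro ⟨y, hy, rfl⟩
  rw [mem_closedBall_zero_iff] at hy
  simp only [sub_zero, zero_add, norm_smul_of_nonneg hr] at hx
  nlinarith

lemma eventually_sqrt_log_div_lt {ε : ℝ} (hε : 0 < ε) :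
    ∀ᶠ n : ℕ in Filter.atTop, √(Real.log n / n) < ε := by
  have h : Filter.Tendsto (fun x : ℝ => √(Real.log x / x)) Filter.atTop (nhds 0) := by
    have h1 := (Real.tendsto_pow_log_div_mul_add_atTop 1 0 1 one_ne_zero).sqrt
    simpa using h1
  exact (h.comp tendsto_natCast_atTop_atTop).eventually (gt_mem_nhds hε)

lemma eventually_mul_pow_le_pow :
    ∀ᶠ m : ℕ in Filter.atTop, (16 : ℝ) * m * (17 / 10) ^ (m - 1) ≤ (9 / 5) ^ m := by
  have h := tendsto_self_mul_const_pow_of_lt_one (r := (17 / 18 : ℝ)) (by norm_num) (by norm_num)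
  filter_upwards [h.eventually (gt_mem_nhds (show (0 : ℝ) < 17 / 160 by norm_num)),
    Filter.eventually_ge_atTop 1] with m hm hm1
  obtain ⟨k, rfl⟩ := Nat.exists_eq_add_of_le' hm1
  have h2 : (17 / 18 : ℝ) ^ (k + 1) * (9 / 5) ^ (k + 1) = 17 / 10 * (17 / 10) ^ k := by
    rw [← mul_pow]
    norm_num [pow_succ, mul_comm]
  have h3 := mul_le_mul_of_nonneg_right hm.le (show (0 : ℝ) ≤ (9 / 5) ^ (k + 1) by positivity)
  rw [mul_assoc, h2] at h3
  rw [Nat.add_sub_cancel]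
  linarith

lemma lt_norm_centerOfMass_ballTruncatedCone {m : ℕ} (hm : 1 ≤ m)
    (h : 20 * √(Real.log (m + 1 : ℕ) / (m + 1 : ℕ)) < 1) :
    (1 - 20 * √(Real.log (m + 1 : ℕ) / (m + 1 : ℕ))) * (m + 1 : ℕ) <
      ‖centerOfMass (ballTruncatedCone m)‖ := by
  have hm' : (1 : ℝ) ≤ m := by exact_mod_cast hm
  push_cast at h ⊢
  set L := Real.log ((m : ℝ) + 1) with hL
  have hLpos : 0 < L := Real.log_pos (by linarith)
  set t := √(L / (m + 1)) with ht
  have ht0 : 0 < t := Real.sqrt_pos.2 (by positivity)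
  have hlog0 : 1 ≤ Real.log (4 * m) := by
    rw [Real.le_log_iff_exp_le (by positivity)]
    linarith [Real.exp_one_lt_d9]
  have hlog : Real.log (4 * m) ≤ 3 * L := by
    have h3 : Real.log (4 * m) ≤ Real.log (((m : ℝ) + 1) ^ 3) :=
      Real.log_le_log (by positivity) (by nlinarith [sq_nonneg ((m : ℝ) - 1)])
    rw [Real.log_pow] at h3
    simpa [hL] using h3
  -- the choice of `δ` makes the caps of height `δ` have volume fraction at most `1 / (4 * m)`
  set δ := √(2 * Real.log (4 * m) / m) with hδ
  have hδ0 : 0 < δ := Real.sqrt_pos.2 (by positivity)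
  have hmδ : m * δ ^ 2 = 2 * Real.log (4 * m) := by
    rw [hδ, Real.sq_sqrt (by positivity)]
    field_simp
  have hδt : δ ≤ 7 / 2 * t := by
    refine le_of_sq_le_sq ?_ (by positivity)
    rw [hδ, mul_pow, ht, Real.sq_sqrt (by positivity), Real.sq_sqrt (by positivity)]
    calc 2 * Real.log (4 * m) / m ≤ 6 * L / m :=
          div_le_div_of_nonneg_right (by linarith) (by positivity)
      _ ≤ 12 * L / (m + 1) := by
        rw [div_le_div_iff₀ (by positivity) (by positivity)]
        nlinarith
      _ ≤ _ := by
        have : 0 ≤ L / (m + 1) := by positivity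
        rw [mul_div_assoc]
        linarith
  refine lt_of_lt_of_le ?_ (le_norm_centerOfMass_ballTruncatedCone hm hδ0 (by linarith)
    (by linarith) ?_)
  · exact mul_lt_mul_of_pos_right (by linarith) (by positivity)
  · rw [hmδ, mul_div_cancel_left₀ _ two_ne_zero, Real.exp_neg, Real.exp_log (by positivity),
      one_div]

theorem theorem1 :
    ∃ C₀ C₁ C₂ : ℝ, 0 < C₀ ∧ 0 < C₁ ∧ 0 < C₂ ∧ ∃ N : ℕ, ∀ n : ℕ, N ≤ n →
      -- centers of mass outside the dilated John ellipsoid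
      ((∃ K : Set (EuclideanSpace ℝ (Fin n)), IsConvexBody K ∧
          ∃ (c : EuclideanSpace ℝ (Fin n)) (E : Set (EuclideanSpace ℝ (Fin n))),
            IsJohnEllipsoid c E K ∧
            centerOfMass K ∉
              dilate c ((1 - C₀ * Real.sqrt (Real.log (n : ℝ) / (n : ℝ))) * (n : ℝ)) E) ∧
        (∃ P : Set (EuclideanSpace ℝ (Fin n)), IsConvexBody P ∧ IsPolytope P ∧
          (facets P).Finite ∧ ((facets P).ncard : ℝ) ≤ C₂ * (n : ℝ) ^ 2 ∧
          ∃ (c : EuclideanSpace ℝ (Fin n)) (E : Set (EuclideanSpace ℝ (Fin n))),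
            IsJohnEllipsoid c E P ∧
            centerOfMass P ∉ dilate c (C₁ * ((n : ℝ) / Real.log (n : ℝ))) E)) ∧
      -- the same in John's position
      ((∃ K : Set (EuclideanSpace ℝ (Fin n)), IsConvexBody K ∧ InJohnPosition K ∧
          (1 - C₀ * Real.sqrt (Real.log (n : ℝ) / (n : ℝ))) * (n : ℝ) ≤ ‖centerOfMass K‖) ∧
        (∃ P : Set (EuclideanSpace ℝ (Fin n)), IsConvexBody P ∧ IsPolytope P ∧
          InJohnPosition P ∧
          (facets P).Finite ∧ ((facets P).ncard : ℝ) ≤ C₂ * (n : ℝ) ^ 2 ∧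
          C₁ * ((n : ℝ) / Real.log (n : ℝ)) ≤ ‖centerOfMass P‖)) := by
  obtain ⟨N₁, hN₁⟩ := Filter.eventually_atTop.1
    (eventually_sqrt_log_div_lt (show (0 : ℝ) < 1 / 20 by norm_num))
  obtain ⟨N₂, hN₂⟩ := Filter.eventually_atTop.1 eventually_mul_pow_le_pow
  refine ⟨20, 1 / 100, 4, by norm_num, by norm_num, by norm_num, N₁ + N₂ + 121, fun n hn => ?_⟩
  obtain ⟨m, rfl⟩ : ∃ m, n = m + 1 := ⟨n - 1, by omega⟩
  have hm : 1 ≤ m := by omega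
  have ht : 20 * √(Real.log (m + 1 : ℕ) / (m + 1 : ℕ)) < 1 := by
    linarith [hN₁ (m + 1) (by omega)]
  have hball := lt_norm_centerOfMass_ballTruncatedCone hm ht
  have hballJohn := inJohnPosition_of_subset_coneOverCube hm
    closedBall_subset_ballTruncatedCone (Set.inter_subset_left (s := coneOverCube m))
  have hpairJohn := inJohnPosition_of_subset_coneOverCube hm
    closedBall_subset_pairTruncatedCone (Set.inter_subset_left (s := coneOverCube m))
  have hlog : 1 ≤ Real.log (m + 1 : ℕ) := by
    rw [Real.le_log_iff_exp_le (by positivity)]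
    have : (3 : ℝ) ≤ (m + 1 : ℕ) := by exact_mod_cast (by omega : 3 ≤ m + 1)
    linarith [Real.exp_one_lt_d9]
  have hpair : 1 / 100 * (((m + 1 : ℕ) : ℝ) / Real.log (m + 1 : ℕ)) <
      ‖centerOfMass (pairTruncatedCone m)‖ := by
    refine lt_of_lt_of_le ?_
      (le_norm_centerOfMass_pairTruncatedCone (by omega) (hN₂ m (by omega)))
    have h1 : ((m + 1 : ℕ) : ℝ) / Real.log (m + 1 : ℕ) ≤ (m + 1 : ℕ) :=
      div_le_self (by positivity) hlog
    have h2 : (0 : ℝ) < m + 1 := by positivity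
    push_cast at h1 ⊢
    linarith
  obtain ⟨hfacets, hcard⟩ := facets_pairTruncatedCone hm
  have hcard' : ((facets (pairTruncatedCone m)).ncard : ℝ) ≤ 4 * ((m + 1 : ℕ) : ℝ) ^ 2 := by
    exact_mod_cast hcard
  exact ⟨⟨⟨ballTruncatedCone m, isConvexBody_ballTruncatedCone hm, 0, _, hballJohn,
        notMem_dilate_closedBall (mul_nonneg (by linarith) (by positivity)) hball⟩,
      ⟨pairTruncatedCone m, isConvexBody_pairTruncatedCone hm, isPolytope_pairTruncatedCone hm,
        hfacets, hcard', 0, _, hpairJohn, notMem_dilate_closedBall (by positivity) hpair⟩⟩,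
    ⟨⟨ballTruncatedCone m, isConvexBody_ballTruncatedCone hm, hballJohn, hball.le⟩,
      ⟨pairTruncatedCone m, isConvexBody_pairTruncatedCone hm, isPolytope_pairTruncatedCone hm,
        hpairJohn, hfacets, hcard', hpair.le⟩⟩⟩
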